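/- For positive integers $d_1,d_2$ let $K$ be the set of real $d_1\times d_2$ matrices with nuclear norm at most $1$. A real $d_1\times d_2$ matrix $X$ determines outcomes of comparisons (Bradley--Terry--Luce model): for $1\le i\le d_1$ and $1\le j,k\le d_2$, the outcome $Y_{ijk}\in\{-1,1\}$ equals $1$ with probability $e^{x}/(1+e^{x})$, where $x=X_{ij}-X_{ik}$, and the outcomes of different comparisons are independent; $\mathbb E_X$ is the corresponding expectation. Let $\mathbb P_{X,m}$ be the law of the comparisons and outcomes observed in a uniform sample of size $m$, in either of the following senses: (a) $m$ is real, $\Omega$ is a random set of triples $(i,j,k)$ with any law (not depending on $X$) for which every triple belongs to $\Omega$ with probability $m/(d_1d_2^2)$ (for example independently of the other triples, or $\Omega$ is a uniformly random set of exactly $m$ triples), and $\Omega$ together with $(Y_{ijk})_{(i,j,k)\in\Omega}$ is observed, with $\Omega$ independent of $Y$; (b) $m\ge 0$ is an integer, and $m$ independent uniformly random triples are observed, each with its own independent outcome. There are universal constants $0<c<C$ such that the following holds. Let $\mathcal L:\mathbb R\to\mathbb R$ be differentiable at $0$ with $\mathcal L'(0)<0$. Then there is $\gamma_0>0$, depending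 only on $\mathcal L$, such that for all $0<\gamma<\gamma_0$, all $\lambda>0$ and all integers $d_1,d_2$ with $d_2\ge2$ for which $B:=\lambda\gamma^{-2}$ is an integer with $B\le d_1$, there is a finite set $\mathcal X\subset\sqrt{\lambda d_1d_2}\,K$ of at least $\exp(cBd_2)$ real $d_1\times d_2$ matrices such that for any two distinct $X^1,X^2\in\mathcal X$ $$\frac1{d_1d_2^2}\sum_{i=1}^{d_1}\sum_{j,k=1}^{d_2}\mathbb E_{X^1}\big[\mathcal L(Y_{ijk}(X^2_{ij}-X^2_{ik}))-\mathcal L(Y_{ijk}(X^1_{ij}-X^1_{ik}))\big]\ \ge\ c\,|\mathcal L'(0)|\,\gamma^2,$$ and for all $X^1,X^2\in\mathcal X$, in each of the senses (a) and (b) and for every $m$, $$D(\mathbb P_{X^1,m}\,\|\,\mathbb P_{X^2,m})\le C\,m\,\gamma^2,$$ where $D$ is the Kullback--Leibler divergence. -/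

import Mathlib

open MeasureTheory ProbabilityTheory InformationTheory
open scoped ENNReal Pointwise

noncomputable section

/-- A comparison `(i, j, k)`: user `i` compares item `j` with item `k`. -/
abbrev Triple (d₁ d₂ : ℕ) : Type := Fin d₁ × Fin d₂ × Fin d₂

/-- The score difference `X i j - X i k` of a comparison `(i, j, k)`. -/
def scoreDiff {d₁ d₂ : ℕ} (X : Matrix (Fin d₁) (Fin d₂) ℝ) (t : Triple d₁ d₂) : ℝ :=
  X t.1 t.2.1 - X t.1 t.2.2

/-- The nuclear norm of a real matrix: the sum of its singular values. -/
def nuclearNorm {d₁ d₂ : ℕ} (X : Matrix (Fin d₁) (Fin d₂) ℝ) : ℝ :=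
  ∑ l ∈ Finset.range d₂, (Matrix.toEuclideanLin X).singularValues l

/-- The unit ball `K` of the nuclear norm. -/
def nuclearBall (d₁ d₂ : ℕ) : Set (Matrix (Fin d₁) (Fin d₂) ℝ) :=
  {X | nuclearNorm X ≤ 1}

/-- The Bradley-Terry-Luce law of the outcome of the comparison `t` under the score matrix `X`:
the outcome is `1` with probability `exp x / (1 + exp x)`, where `x` is the score difference, and
`-1` otherwise. -/
def outcomeLaw {d₁ d₂ : ℕ} (X : Matrix (Fin d₁) (Fin d₂) ℝ) (t : Triple d₁ d₂) : Measure ℤ :=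
  bernoulliMeasure (1 : ℤ) (-1) (unitInterval.sigmoid (scoreDiff X t))

/-- The excess expected loss of `X₂` over `X₁`, averaged over all comparisons `(i, j, k)`, when the
outcomes are drawn under `X₁`. -/
def averageExcessLoss {d₁ d₂ : ℕ} (L : ℝ → ℝ) (X₁ X₂ : Matrix (Fin d₁) (Fin d₂) ℝ) : ℝ :=
  1 / ((d₁ : ℝ) * (d₂ : ℝ) ^ 2) * ∑ i : Fin d₁, ∑ j : Fin d₂, ∑ k : Fin d₂,
    ∫ y, (L ((y : ℝ) * (X₂ i j - X₂ i k)) - L ((y : ℝ) * (X₁ i j - X₁ i k)))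
      ∂(outcomeLaw X₁ (i, j, k))

/-- The law `ν` of a random set of comparisons is uniform with (expected) sample size `m` if every
comparison belongs to the random set with probability `m / (d₁ d₂²)`. Taking all comparisons
independently with this probability, or a uniformly random set of exactly `m` comparisons,
are examples. -/
def IsUniformSetSampling {d₁ d₂ : ℕ} (ν : Measure (Set (Triple d₁ d₂))) (m : ℝ) : Prop :=
  IsProbabilityMeasure ν ∧
    ∀ t : Triple d₁ d₂, ν.real {Ω | t ∈ Ω} = m / ((d₁ : ℝ) * (d₂ : ℝ) ^ 2)

/-- The law of the data `(Ω, (Y t)_{t ∈ Ω})` under `X`, where `Ω` has law `ν` and is independent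
of the independent outcomes `Y`. Unobserved outcomes are recorded as `0`. -/
def setSampleLaw {d₁ d₂ : ℕ} (ν : Measure (Set (Triple d₁ d₂)))
    (X : Matrix (Fin d₁) (Fin d₂) ℝ) : Measure (Set (Triple d₁ d₂) × (Triple d₁ d₂ → ℤ)) :=
  (ν.prod (Measure.pi (outcomeLaw X))).map (fun p => (p.1, p.1.indicator p.2))

/-- The law under `X` of one uniformly random comparison together with its outcome. -/
def singleSampleLaw {d₁ d₂ : ℕ} (X : Matrix (Fin d₁) (Fin d₂) ℝ) :
    Measure (Triple d₁ d₂ × ℤ) :=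
  ∑ t : Triple d₁ d₂,
    (Fintype.card (Triple d₁ d₂) : ℝ≥0∞)⁻¹ • (Measure.dirac t).prod (outcomeLaw X t)

/-- The law under `X` of `m` independent uniformly random comparisons with their outcomes. -/
def iidSampleLaw {d₁ d₂ : ℕ} (m : ℕ) (X : Matrix (Fin d₁) (Fin d₂) ℝ) :
    Measure (Fin m → Triple d₁ d₂ × ℤ) :=
  Measure.pi (fun _ => singleSampleLaw X)

end

/-! The family consists of matrices with entries `±γ` whose rows repeat with period `B`. Their rank
is at most `B` and their squared Frobenius norm is `γ² d₁ d₂`, so the nuclear norm is at most `√(B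
γ² d₁ d₂) = √(lam d₁ d₂)` (`mem_smul_nuclearBall`). The free bits, about `B d₂ / 2` of them, run
over a Gilbert-Varshamov code (`exists_hammingDist_packing`), so distinct matrices differ in a
constant fraction of the entries.

All score differences lie in `{0, 2γ, -2γ}`. On these three points `L` agrees with a quadratic
polynomial and the centred logistic function with a linear one. Each bit is stored together with its
negation, so all row sums agree; the even part of `L` then cancels, and the excess loss is exactly a
multiple of the squared Frobenius distance (`averageExcessLoss_eq`).

One comparison has divergence at most `8 γ²`, and chain rules for both sampling schemes add these up
(`klDiv_setSampleLaw`, `klDiv_iidSampleLaw`). -/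

/-! ### Binary codes: the Gilbert-Varshamov bound. -/

/-- The generating function of the Hamming weights on the Boolean cube. -/
lemma sum_pow_hammingDist {ι : Type*} [Fintype ι] [DecidableEq ι] (x : ι → Bool) (a : ℝ) :
    ∑ z : ι → Bool, a ^ hammingDist x z = (1 + a) ^ Fintype.card ι := by
  have h (z : ι → Bool) : a ^ hammingDist x z = ∏ i, if x i ≠ z i then a else 1 := by
    rw [Finset.prod_ite, Finset.prod_const, Finset.prod_const_one, mul_one]
    rfl
  simp_rw [h]
  rw [← Fintype.piFinset_univ, ← Finset.prod_univ_sum (fun _ : ι => (Finset.univ : Finset Bool))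
    (fun i b => if x i ≠ b then a else 1)]
  have h' (i : ι) : ∑ b : Bool, (if x i ≠ b then a else 1) = 1 + a := by
    cases x i <;> simp [add_comm]
  simp_rw [h']
  simp

/-- A Hamming ball of relative radius `1 / 8` in the Boolean cube is exponentially small. -/
lemma card_hammingBall_le {ι : Type*} [Fintype ι] [DecidableEq ι] (x : ι → Bool) :
    (({z : ι → Bool | 8 * hammingDist x z ≤ Fintype.card ι} : Finset (ι → Bool)).card : ℝ)
      ≤ (√2 * (17 / 16)) ^ Fintype.card ι := by
  set N := Fintype.card ι
  have hs : (1 : ℝ) ≤ √2 := by rw [Real.one_le_sqrt]; norm_num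
  -- Chernoff weight: `√2 ^ 8 = 16`, so the right side is `16 ^ (N / 8 - dist)`, at least `1` on the
  -- ball.
  have h (z : ι → Bool) (hz : 8 * hammingDist x z ≤ N) :
      (1 : ℝ) ≤ √2 ^ N * (1 / 16) ^ hammingDist x z := by
    have h16 : (√2 ^ 8 : ℝ) = 16 := by
      rw [show 8 = 2 * 4 by norm_num, pow_mul, Real.sq_sqrt (by norm_num)]; norm_num
    calc (1 : ℝ) = √2 ^ (8 * hammingDist x z) * (1 / 16) ^ hammingDist x z := by
          rw [pow_mul, h16, ← mul_pow]; simp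
      _ ≤ _ := by gcongr
  calc _ = ∑ z : ι → Bool, if 8 * hammingDist x z ≤ N then (1 : ℝ) else 0 := by
        rw [Finset.sum_boole]
    _ ≤ ∑ z : ι → Bool, √2 ^ N * (1 / 16) ^ hammingDist x z := by
        refine Finset.sum_le_sum fun z _ => ?_
        split_ifs with hz
        · exact h z hz
        · positivity
    _ = _ := by
        rw [← Finset.mul_sum, sum_pow_hammingDist, ← mul_pow]; norm_num [N]

/-- The Gilbert-Varshamov bound with relative distance `1 / 8`. -/
theorem exists_hammingDist_packing (ι : Type*) [Fintype ι] [DecidableEq ι] :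
    ∃ F : Finset (ι → Bool), Real.exp (Fintype.card ι / 8) ≤ F.card ∧
      ∀ x ∈ F, ∀ y ∈ F, x ≠ y → Fintype.card ι ≤ 8 * hammingDist x y := by
  set N := Fintype.card ι
  let packing (F : Finset (ι → Bool)) : Prop := ∀ x ∈ F, ∀ y ∈ F, x ≠ y → N ≤ 8 * hammingDist x y
  obtain ⟨F, hF⟩ := (Set.toFinite {F | packing F}).exists_maximal
    ⟨∅, fun x hx => absurd hx (Finset.notMem_empty x)⟩
  have hpack : packing F := hF.prop
  refine ⟨F, ?_, hpack⟩
  -- By maximality: an uncovered point could be added to the packing.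
  have hcover (z : ι → Bool) : ∃ x ∈ F, 8 * hammingDist x z ≤ N := by
    by_contra! hz
    have hzF : z ∉ F := fun h => by simpa using hz z h
    have hins : packing (insert z F) := by
      intro x hx y hy hxy
      rcases Finset.mem_insert.1 hx with rfl | hx' <;> rcases Finset.mem_insert.1 hy with rfl | hy'
      · exact absurd rfl hxy
      · rw [hammingDist_comm]; exact (hz y hy').le
      · exact (hz x hx').le
      · exact hpack x hx' y hy' hxy
    exact hzF (hF.le_of_ge hins (Finset.subset_insert z F) (Finset.mem_insert_self z F))
  have hcard : (2 : ℝ) ^ N ≤ F.card * (√2 * (17 / 16)) ^ N := by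
    calc (2 : ℝ) ^ N = ((Finset.univ : Finset (ι → Bool)).card : ℝ) := by
          simp [N, Finset.card_univ]
      _ ≤ ((F.biUnion fun x => ({z | 8 * hammingDist x z ≤ N} : Finset (ι → Bool))).card : ℝ) := by
          gcongr
          intro z _
          simpa using hcover z
      _ ≤ ∑ x ∈ F, (({z | 8 * hammingDist x z ≤ N} : Finset (ι → Bool)).card : ℝ) := by
          exact_mod_cast Finset.card_biUnion_le
      _ ≤ ∑ _x ∈ F, (√2 * (17 / 16)) ^ N := Finset.sum_le_sum fun x _ => card_hammingBall_le x
      _ = _ := by simp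
  -- The covering bound gives `F.card ≥ (2 / (√2 * 17 / 16)) ^ N`; this base is at least `exp (1 /
  -- 8)`.
  have hbase : Real.exp (1 / 8) * (√2 * (17 / 16)) ≤ 2 := by
    have h1 : Real.exp (1 / 8) ≤ 8 / 7 := by
      have := Real.exp_bound_div_one_sub_of_interval (x := 1 / 8) (by norm_num) (by norm_num)
      norm_num at this ⊢
      exact this
    have h2 : √2 ≤ 3 / 2 := by
      rw [Real.sqrt_le_left (by norm_num)]; norm_num
    calc _ ≤ (8 / 7 : ℝ) * (3 / 2 * (17 / 16)) := by gcongr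
      _ ≤ 2 := by norm_num
  have hpos : (0 : ℝ) < (√2 * (17 / 16)) ^ N := by positivity
  refine le_of_mul_le_mul_right (le_trans ?_ hcard) hpos
  rw [show ((N : ℝ) / 8) = N * (1 / 8) by ring, Real.exp_nat_mul, ← mul_pow]
  exact pow_le_pow_left₀ (by positivity) hbase N

/-! ### Nuclear norm, Frobenius norm and rank. -/

/-- The squares of the singular values of a matrix add up to its squared Frobenius norm. -/
lemma sum_sq_singularValues {d₁ d₂ : ℕ} (A : Matrix (Fin d₁) (Fin d₂) ℝ) :
    ∑ l ∈ Finset.range d₂, (Matrix.toEuclideanLin A).singularValues l ^ 2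
      = ∑ i, ∑ j, A i j ^ 2 := by
  set T := Matrix.toEuclideanLin A
  have hn : Module.finrank ℝ (EuclideanSpace ℝ (Fin d₂)) = d₂ := by simp
  rw [← Fin.sum_univ_eq_sum_range (fun l => T.singularValues l ^ 2)]
  simp_rw [T.sq_singularValues_fin hn]
  -- The trace of `T* T` is both the sum of its eigenvalues and, in the standard basis, the sum of
  -- the squared column norms.
  have h := T.isSymmetric_adjoint_comp_self.re_trace_eq_sum_eigenvalues hn
  rw [← h, LinearMap.trace_eq_sum_inner _ (EuclideanSpace.basisFun (Fin d₂) ℝ), Finset.sum_comm]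
  simp only [LinearMap.comp_apply, LinearMap.adjoint_inner_right, RCLike.re_to_real]
  refine Finset.sum_congr rfl fun j _ => ?_
  rw [real_inner_self_eq_norm_sq, EuclideanSpace.real_norm_sq_eq]
  refine Finset.sum_congr rfl fun i _ => ?_
  simp [T, Matrix.toEuclideanLin]

/-- The nuclear norm is at most the Frobenius norm times the square root of the rank. -/
lemma nuclearNorm_sq_le {d₁ d₂ : ℕ} (A : Matrix (Fin d₁) (Fin d₂) ℝ) :
    nuclearNorm A ^ 2 ≤ A.rank * ∑ i, ∑ j, A i j ^ 2 := by
  set T := Matrix.toEuclideanLin A with hT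
  have hrank : A.rank = Module.finrank ℝ T.range := by
    rw [hT, Matrix.toEuclideanLin_eq_toLin_orthonormal]
    exact Matrix.rank_eq_finrank_range_toLin A _ _
  have hsub : (Finset.range d₂).filter (fun l => T.singularValues l ≠ 0) ⊆
      T.singularValues.support := by
    intro l hl
    exact Finsupp.mem_support_iff.2 (Finset.mem_filter.1 hl).2
  rw [nuclearNorm, ← sum_sq_singularValues, ← hT, ← Finset.sum_filter_ne_zero]
  -- Cauchy-Schwarz over the nonzero singular values, whose number is the rank.
  refine sq_sum_le_card_mul_sum_sq.trans ?_
  gcongr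
  · rw [hrank, ← T.card_support_singularValues]
    exact Finset.card_le_card hsub
  · exact Finset.filter_subset _ _

/-! ### Divergence of the observed data. -/

/-- The Kullback-Leibler divergence on a countable space, from the log-likelihood ratio. -/
lemma klDiv_eq_ofReal_integral_of_singleton {α : Type*} [MeasurableSpace α] [Countable α]
    [MeasurableSingletonClass α] {μ η : Measure α} [IsProbabilityMeasure μ]
    [IsProbabilityMeasure η] {h : α → ℝ}
    (hμη : ∀ a, μ {a} = ENNReal.ofReal (Real.exp (h a)) * η {a}) (hint : Integrable h μ) :
    klDiv μ η = ENNReal.ofReal (∫ a, h a ∂μ) := by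
  have hmeas : Measurable fun a => ENNReal.ofReal (Real.exp (h a)) := Measurable.of_discrete
  have hμ : μ = η.withDensity fun a => ENNReal.ofReal (Real.exp (h a)) := by
    refine Measure.ext_of_singleton fun a => ?_
    rw [withDensity_apply _ (measurableSet_singleton a), lintegral_singleton, hμη]
  have hac : μ ≪ η := hμ ▸ withDensity_absolutelyContinuous _ _
  have hllr : llr μ η =ᵐ[μ] h := by
    refine hac.ae_le ?_
    have := η.rnDeriv_withDensity hmeas
    rw [← hμ] at this
    filter_upwards [this] with a ha
    rw [llr, ha, ENNReal.toReal_ofReal (Real.exp_pos _).le, Real.log_exp]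
  rw [klDiv_of_ac_of_integrable hac (hint.congr hllr.symm), integral_congr_ae hllr]
  simp

/-- The log-likelihood ratio of an outcome under the score differences `x₁` and `x₂`. -/
noncomputable def outcomeLogRatio (x₁ x₂ : ℝ) (y : ℤ) : ℝ :=
  if y = 1 then Real.log (Real.sigmoid x₁ / Real.sigmoid x₂)
  else Real.log (Real.sigmoid (-x₁) / Real.sigmoid (-x₂))

section

variable {d₁ d₂ : ℕ}

instance (X : Matrix (Fin d₁) (Fin d₂) ℝ) (t : Triple d₁ d₂) :
    IsProbabilityMeasure (outcomeLaw X t) := by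
  unfold outcomeLaw; infer_instance

lemma outcomeLaw_singleton (X : Matrix (Fin d₁) (Fin d₂) ℝ) (t : Triple d₁ d₂) (y : ℤ) :
    outcomeLaw X t {y} = ENNReal.ofReal (if y = 1 then Real.sigmoid (scoreDiff X t)
      else if y = -1 then Real.sigmoid (-scoreDiff X t) else 0) := by
  have h := bernoulliMeasure_real_apply (x := (1 : ℤ)) (y := -1)
    (unitInterval.sigmoid (scoreDiff X t)) (measurableSet_singleton y)
  rw [outcomeLaw, ← ENNReal.ofReal_toReal (measure_ne_top _ {y}), ← measureReal_def, h]
  congr 1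
  have h1 : ((unitInterval.sigmoid (scoreDiff X t) : unitInterval) : ℝ)
    = Real.sigmoid (scoreDiff X t) := rfl
  rcases eq_or_ne y 1 with rfl | hy
  · simp [h1]
  · rcases eq_or_ne y (-1) with rfl | hy'
    · simp [h1, Real.sigmoid_neg]
    · simp [hy, hy', hy.symm, hy'.symm]

lemma outcomeLaw_singleton_eq_mul (X₁ X₂ : Matrix (Fin d₁) (Fin d₂) ℝ) (t : Triple d₁ d₂) (y : ℤ) :
    outcomeLaw X₁ t {y} =
      ENNReal.ofReal (Real.exp (outcomeLogRatio (scoreDiff X₁ t) (scoreDiff X₂ t) y)) *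
        outcomeLaw X₂ t {y} := by
  have hs := Real.sigmoid_pos
  rw [outcomeLaw_singleton, outcomeLaw_singleton, ← ENNReal.ofReal_mul (Real.exp_pos _).le,
    outcomeLogRatio]
  congr 1
  split_ifs
  · rw [Real.exp_log (div_pos (hs _) (hs _)), div_mul_cancel₀ _ (hs _).ne']
  · rw [Real.exp_log (div_pos (hs _) (hs _)), div_mul_cancel₀ _ (hs _).ne']
  · simp

lemma integrable_outcomeLaw (X : Matrix (Fin d₁) (Fin d₂) ℝ) (t : Triple d₁ d₂) (f : ℤ → ℝ) :
    Integrable f (outcomeLaw X t) :=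
  integrable_bernoulliMeasure _ _ _ _

lemma integral_outcomeLaw (X : Matrix (Fin d₁) (Fin d₂) ℝ) (t : Triple d₁ d₂) (f : ℤ → ℝ) :
    ∫ y, f y ∂outcomeLaw X t = Real.sigmoid (scoreDiff X t) * f 1
      + Real.sigmoid (-scoreDiff X t) * f (-1) := by
  rw [outcomeLaw, integral_bernoulliMeasure, Real.sigmoid_neg]
  rfl

/-- The divergence of two outcomes is bounded by its symmetrization. -/
lemma integral_outcomeLogRatio_le (X₁ X₂ : Matrix (Fin d₁) (Fin d₂) ℝ) (t : Triple d₁ d₂) :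
    ∫ y, outcomeLogRatio (scoreDiff X₁ t) (scoreDiff X₂ t) y ∂outcomeLaw X₁ t ≤
      (Real.sigmoid (scoreDiff X₁ t) - Real.sigmoid (scoreDiff X₂ t)) *
        (scoreDiff X₁ t - scoreDiff X₂ t) := by
  rw [integral_outcomeLaw]
  generalize scoreDiff X₁ t = x₁
  generalize scoreDiff X₂ t = x₂
  have hs := Real.sigmoid_pos
  have hne (x : ℝ) : Real.sigmoid x ≠ 0 := (hs x).ne'
  -- The score difference is the log-odds of the outcome.
  have hodds (x : ℝ) : Real.log (Real.sigmoid x) - Real.log (Real.sigmoid (-x)) = x := by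
    rw [← Real.sigmoid_mul_rexp_neg x, Real.log_mul (hne x) (Real.exp_ne_zero _), Real.log_exp]
    ring
  have hgibbs (x : ℝ) (y : ℝ) : Real.sigmoid y * (Real.log (Real.sigmoid x) -
      Real.log (Real.sigmoid y)) ≤ Real.sigmoid x - Real.sigmoid y := by
    rw [← Real.log_div (hne x) (hne y)]
    calc _ ≤ Real.sigmoid y * (Real.sigmoid x / Real.sigmoid y - 1) := by
          gcongr
          · exact (hs y).le
          · exact Real.log_le_sub_one_of_pos (div_pos (hs x) (hs y))
      _ = _ := by rw [mul_sub, mul_div_cancel₀ _ (hne y), mul_one]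
  -- Together `h1` and `h2` say that the reverse divergence is nonnegative; adding it to the
  -- divergence gives the symmetrized form.
  have h1 := hgibbs x₁ x₂
  have h2 := hgibbs (-x₁) (-x₂)
  have o1 := hodds x₁
  have o2 := hodds x₂
  simp only [outcomeLogRatio, if_true, show ¬ ((-1 : ℤ) = 1) by norm_num, if_false,
    Real.log_div (hne _) (hne _)]
  rw [Real.sigmoid_neg, Real.sigmoid_neg] at *
  set p := Real.sigmoid x₁
  set q := Real.sigmoid x₂
  rw [← o1, ← o2]
  nlinarith

instance (ν : Measure (Set (Triple d₁ d₂))) [IsProbabilityMeasure ν]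
    (X : Matrix (Fin d₁) (Fin d₂) ℝ) : IsProbabilityMeasure (setSampleLaw ν X) :=
  Measure.isProbabilityMeasure_map (Measurable.of_discrete).aemeasurable

open Classical in
lemma setSampleLaw_singleton (ν : Measure (Set (Triple d₁ d₂))) [IsProbabilityMeasure ν]
    (X : Matrix (Fin d₁) (Fin d₂) ℝ) (Ω : Set (Triple d₁ d₂)) (y : Triple d₁ d₂ → ℤ) :
    setSampleLaw ν X {(Ω, y)} =
      ν {Ω} * ∏ t, if t ∈ Ω then outcomeLaw X t {y t} else if y t = 0 then 1 else 0 := by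
  -- The preimage is a product set: coordinates in `Ω` are pinned to `y t`, the others are free,
  -- provided that `y t = 0`.
  have hpre : (fun p : Set (Triple d₁ d₂) × (Triple d₁ d₂ → ℤ) => (p.1, p.1.indicator p.2)) ⁻¹'
      {(Ω, y)} = {Ω} ×ˢ Set.univ.pi fun t =>
        if t ∈ Ω then {y t} else if y t = 0 then Set.univ else ∅ := by
    ext ⟨Ω', z⟩
    simp only [Set.mem_preimage, Set.mem_singleton_iff, Prod.mk.injEq, Set.mem_prod, Set.mem_pi,
      Set.mem_univ, true_imp_iff, funext_iff]
    refine and_congr_right ?_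
    rintro rfl
    refine forall_congr' fun t => ?_
    by_cases ht : t ∈ Ω'
    · simp [ht]
    · by_cases hy : y t = 0 <;> simp [ht, hy, eq_comm]
  rw [setSampleLaw, Measure.map_apply Measurable.of_discrete (measurableSet_singleton _), hpre,
    Measure.prod_prod, Measure.pi_pi]
  congr 1
  refine Finset.prod_congr rfl fun t _ => ?_
  split_ifs <;> simp

open Classical in
/-- The chain rule for the divergence of two laws of the data on a random set of comparisons. -/
lemma klDiv_setSampleLaw (ν : Measure (Set (Triple d₁ d₂))) [IsProbabilityMeasure ν]
    (X₁ X₂ : Matrix (Fin d₁) (Fin d₂) ℝ) :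
    klDiv (setSampleLaw ν X₁) (setSampleLaw ν X₂) = ENNReal.ofReal (∑ t : Triple d₁ d₂,
      ν.real {Ω | t ∈ Ω} *
        ∫ y, outcomeLogRatio (scoreDiff X₁ t) (scoreDiff X₂ t) y ∂outcomeLaw X₁ t) := by
  let h (t : Triple d₁ d₂) := outcomeLogRatio (scoreDiff X₁ t) (scoreDiff X₂ t)
  let H (p : Set (Triple d₁ d₂) × (Triple d₁ d₂ → ℤ)) : ℝ :=
    ∑ t, if t ∈ p.1 then h t (p.2 t) else 0
  have hratio (p) : setSampleLaw ν X₁ {p} =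
      ENNReal.ofReal (Real.exp (H p)) * setSampleLaw ν X₂ {p} := by
    obtain ⟨Ω, y⟩ := p
    rw [setSampleLaw_singleton, setSampleLaw_singleton, mul_left_comm, Real.exp_sum,
      ENNReal.ofReal_prod_of_nonneg fun _ _ => (Real.exp_pos _).le, ← Finset.prod_mul_distrib]
    congr 1
    refine Finset.prod_congr rfl fun t _ => ?_
    by_cases ht : t ∈ Ω
    · simp [ht, h, outcomeLaw_singleton_eq_mul X₁ X₂]
    · simp [ht]
  -- Each summand is a function of `Ω` times a function of `Y`. By independence only the
  -- probabilities of `t ∈ Ω` enter, whatever the joint law of the inclusions.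
  let G (t : Triple d₁ d₂) (p : Set (Triple d₁ d₂) × (Triple d₁ d₂ → ℤ)) : ℝ :=
    {Ω : Set (Triple d₁ d₂) | t ∈ Ω}.indicator 1 p.1 * h t (p.2 t)
  have hG (t) : Integrable (G t) (ν.prod (Measure.pi (outcomeLaw X₁))) := by
    refine Integrable.mul_prod (f := {Ω : Set (Triple d₁ d₂) | t ∈ Ω}.indicator (1 : Set (Triple d₁ d₂) → ℝ))
      (g := fun y : Triple d₁ d₂ → ℤ => h t (y t)) ?_ ?_
    · exact (integrable_const 1).indicator MeasurableSet.of_discrete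
    · exact integrable_comp_eval (μ := outcomeLaw X₁) (integrable_outcomeLaw X₁ t (h t))
  have hHG : H ∘ (fun p : Set (Triple d₁ d₂) × (Triple d₁ d₂ → ℤ) => (p.1, p.1.indicator p.2))
      = fun p => ∑ t, G t p := by
    funext p
    refine Finset.sum_congr rfl fun t _ => ?_
    by_cases ht : t ∈ p.1 <;> simp [G, ht]
  have hf : AEMeasurable (fun p : Set (Triple d₁ d₂) × (Triple d₁ d₂ → ℤ) =>
    (p.1, p.1.indicator p.2)) (ν.prod (Measure.pi (outcomeLaw X₁))) :=
    Measurable.of_discrete.aemeasurable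
  have hHm : AEStronglyMeasurable H (setSampleLaw ν X₁) :=
    (Measurable.of_discrete).aestronglyMeasurable
  have hint : Integrable H (setSampleLaw ν X₁) := by
    rw [setSampleLaw, integrable_map_measure hHm hf, hHG]
    exact integrable_finsetSum _ fun t _ => hG t
  rw [klDiv_eq_ofReal_integral_of_singleton hratio hint]
  congr 1
  calc ∫ p, H p ∂setSampleLaw ν X₁
      = ∫ p, ∑ t, G t p ∂(ν.prod (Measure.pi (outcomeLaw X₁))) := by
        rw [setSampleLaw, integral_map hf hHm, ← hHG]; rfl
    _ = ∑ t, ∫ p, G t p ∂(ν.prod (Measure.pi (outcomeLaw X₁))) :=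
        integral_finsetSum _ fun t _ => hG t
    _ = _ := by
        refine Finset.sum_congr rfl fun t _ => ?_
        rw [integral_prod_mul ({Ω : Set (Triple d₁ d₂) | t ∈ Ω}.indicator (1 : Set (Triple d₁ d₂) → ℝ))
          (fun y : Triple d₁ d₂ → ℤ => h t (y t)), integral_indicator_one MeasurableSet.of_discrete,
          integral_comp_eval (μ := outcomeLaw X₁) (f := h t)
            (integrable_outcomeLaw X₁ t (h t)).aestronglyMeasurable]

lemma singleSampleLaw_singleton (X : Matrix (Fin d₁) (Fin d₂) ℝ) (t : Triple d₁ d₂) (y : ℤ) :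
    singleSampleLaw X {(t, y)} =
      (Fintype.card (Triple d₁ d₂) : ℝ≥0∞)⁻¹ * outcomeLaw X t {y} := by
  classical
  rw [singleSampleLaw, Measure.finsetSum_apply, Finset.sum_eq_single t]
  · rw [Measure.smul_apply, ← Set.singleton_prod_singleton, Measure.prod_prod]
    simp
  · intro s _ hs
    rw [Measure.smul_apply, ← Set.singleton_prod_singleton, Measure.prod_prod]
    simp [hs]
  · simp

lemma isProbabilityMeasure_singleSampleLaw [Nonempty (Triple d₁ d₂)]
    (X : Matrix (Fin d₁) (Fin d₂) ℝ) : IsProbabilityMeasure (singleSampleLaw X) := by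
  refine ⟨?_⟩
  rw [singleSampleLaw, Measure.finsetSum_apply]
  simp only [Measure.smul_apply, measure_univ, smul_eq_mul, mul_one, Finset.sum_const,
    Finset.card_univ, nsmul_eq_mul]
  exact ENNReal.mul_inv_cancel (Nat.cast_ne_zero.2 Fintype.card_ne_zero) (ENNReal.natCast_ne_top _)

/-- The chain rule for the divergence of two laws of independent comparisons. -/
lemma klDiv_iidSampleLaw [Nonempty (Triple d₁ d₂)] (m : ℕ) (X₁ X₂ : Matrix (Fin d₁) (Fin d₂) ℝ) :
    klDiv (iidSampleLaw m X₁) (iidSampleLaw m X₂) = ENNReal.ofReal (m * ∑ t : Triple d₁ d₂,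
      (Fintype.card (Triple d₁ d₂) : ℝ)⁻¹ *
        ∫ y, outcomeLogRatio (scoreDiff X₁ t) (scoreDiff X₂ t) y ∂outcomeLaw X₁ t) := by
  have := isProbabilityMeasure_singleSampleLaw X₁
  have := isProbabilityMeasure_singleSampleLaw X₂
  have : IsProbabilityMeasure (iidSampleLaw m X₁) := by unfold iidSampleLaw; infer_instance
  have : IsProbabilityMeasure (iidSampleLaw m X₂) := by unfold iidSampleLaw; infer_instance
  let h (p : Triple d₁ d₂ × ℤ) : ℝ := outcomeLogRatio (scoreDiff X₁ p.1) (scoreDiff X₂ p.1) p.2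
  have hcard : (Fintype.card (Triple d₁ d₂) : ℝ≥0∞)⁻¹ ≠ ∞ :=
    ENNReal.inv_ne_top.2 (Nat.cast_ne_zero.2 Fintype.card_ne_zero)
  have hh (t : Triple d₁ d₂) : Integrable h ((Measure.dirac t).prod (outcomeLaw X₁ t)) := by
    rw [Measure.dirac_prod, integrable_map_measure
      (Measurable.of_discrete).aestronglyMeasurable (Measurable.of_discrete).aemeasurable]
    exact integrable_outcomeLaw X₁ t _
  have hint : Integrable h (singleSampleLaw X₁) := by
    rw [singleSampleLaw, integrable_finsetSum_measure]
    exact fun t _ => (hh t).smul_measure hcard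
  have hintegral : ∫ p, h p ∂singleSampleLaw X₁ = ∑ t : Triple d₁ d₂,
      (Fintype.card (Triple d₁ d₂) : ℝ)⁻¹ *
        ∫ y, outcomeLogRatio (scoreDiff X₁ t) (scoreDiff X₂ t) y ∂outcomeLaw X₁ t := by
    rw [singleSampleLaw, integral_finsetSum_measure fun t _ => (hh t).smul_measure hcard]
    refine Finset.sum_congr rfl fun t _ => ?_
    rw [integral_smul_measure, Measure.dirac_prod, integral_map
      (Measurable.of_discrete).aemeasurable (Measurable.of_discrete).aestronglyMeasurable]
    simp [h]
  have hratio (z : Fin m → Triple d₁ d₂ × ℤ) : iidSampleLaw m X₁ {z} =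
      ENNReal.ofReal (Real.exp (∑ l, h (z l))) * iidSampleLaw m X₂ {z} := by
    rw [iidSampleLaw, iidSampleLaw, Measure.pi_singleton, Measure.pi_singleton, Real.exp_sum,
      ENNReal.ofReal_prod_of_nonneg fun _ _ => (Real.exp_pos _).le, ← Finset.prod_mul_distrib]
    refine Finset.prod_congr rfl fun l _ => ?_
    obtain ⟨t, y⟩ := z l
    rw [singleSampleLaw_singleton, singleSampleLaw_singleton, outcomeLaw_singleton_eq_mul X₁ X₂,
      mul_left_comm]
  have hl (l : Fin m) : Integrable (fun z : Fin m → Triple d₁ d₂ × ℤ => h (z l))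
      (iidSampleLaw m X₁) :=
    integrable_comp_eval (μ := fun _ => singleSampleLaw X₁) hint
  rw [klDiv_eq_ofReal_integral_of_singleton hratio (integrable_finsetSum _ fun l _ => hl l),
    integral_finsetSum _ fun l _ => hl l, ← hintegral]
  congr 1
  have he (l : Fin m) : ∫ z, h (z l) ∂iidSampleLaw m X₁ = ∫ p, h p ∂singleSampleLaw X₁ :=
    integral_comp_eval (μ := fun _ => singleSampleLaw X₁) hint.aestronglyMeasurable
  simp [he]

end

/-! ### Divergence and excess loss of sign matrices. -/

lemma sum_sub_mul_sub {d : ℕ} (a b : Fin d → ℝ) :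
    ∑ j, ∑ k, (a j - a k) * (b j - b k) = 2 * (d * ∑ j, a j * b j - (∑ j, a j) * ∑ j, b j) := by
  have h (j k : Fin d) : (a j - a k) * (b j - b k) = a j * b j + a k * b k - a j * b k - b j * a k := by
    ring
  simp_rw [h, Finset.sum_sub_distrib, Finset.sum_add_distrib, ← Finset.mul_sum, ← Finset.sum_mul]
  simp only [Finset.sum_const, Finset.card_univ, Fintype.card_fin, nsmul_eq_mul]
  have hc : ∑ x, a x * (d * b x) = d * ∑ x, a x * b x := by
    rw [Finset.mul_sum]
    exact Finset.sum_congr rfl fun x _ => mul_left_comm _ _ _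
  rw [hc]
  ring

/-- The slope of the logistic function between `0` and `2 * γ`, up to a factor `2`. -/
noncomputable def sigmoidSlope (γ : ℝ) : ℝ := (2 * Real.sigmoid (2 * γ) - 1) / (2 * γ)

/-- With `u = exp (-2γ)` the slope is `(1 - u) / ((1 + u) 2γ)`. The upper bound follows from `1 - 2γ
≤ u`; the lower one from `u ≤ 1 / (1 + 2γ)`, which gives `1 / (2 (1 + γ)) ≥ 1 / 4`. -/
lemma sigmoidSlope_bounds {γ : ℝ} (hγ : 0 < γ) (hγ1 : γ ≤ 1) :
    1 / 4 ≤ sigmoidSlope γ ∧ sigmoidSlope γ ≤ 1 := by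
  have hexp : 1 - 2 * γ ≤ Real.exp (-(2 * γ)) := by
    have := Real.add_one_le_exp (-(2 * γ)); linarith
  have hinv : Real.exp (-(2 * γ)) * (1 + 2 * γ) ≤ 1 := by
    have := Real.add_one_le_exp (2 * γ)
    calc _ ≤ Real.exp (-(2 * γ)) * Real.exp (2 * γ) := by gcongr; linarith
      _ = 1 := by rw [← Real.exp_add]; simp
  have hpos := Real.exp_pos (-(2 * γ))
  rw [sigmoidSlope, Real.sigmoid_def]
  set u := Real.exp (-(2 * γ))
  have hu : 2 * (1 + u)⁻¹ - 1 = (1 - u) / (1 + u) := by field_simp; ring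
  rw [hu, div_div, le_div_iff₀ (by positivity), div_le_one (by positivity)]
  constructor <;> nlinarith

/-- An odd function is linear on three points symmetric about `0`. -/
lemma two_mul_sigmoid_sub_one {γ x : ℝ} (hγ : γ ≠ 0) (hx : x = 0 ∨ x = 2 * γ ∨ x = -(2 * γ)) :
    2 * Real.sigmoid x - 1 = sigmoidSlope γ * x := by
  rw [sigmoidSlope]
  rcases hx with rfl | rfl | rfl
  · simp
  · field_simp
  · rw [Real.sigmoid_neg]; field_simp; ring

section

variable {d₁ d₂ : ℕ}

lemma scoreDiff_eq_of_sign {γ : ℝ} {X : Matrix (Fin d₁) (Fin d₂) ℝ}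
    (hX : ∀ i j, X i j = γ ∨ X i j = -γ) (t : Triple d₁ d₂) :
    scoreDiff X t = 0 ∨ scoreDiff X t = 2 * γ ∨ scoreDiff X t = -(2 * γ) := by
  rw [scoreDiff]
  rcases hX t.1 t.2.1 with h | h <;> rcases hX t.1 t.2.2 with h' | h' <;> rw [h, h']
  · left; ring
  · right; left; ring
  · right; right; ring
  · left; ring

lemma integral_outcomeLogRatio_le_of_sign {γ : ℝ} (hγ : 0 < γ) (hγ1 : γ ≤ 1)
    {X₁ X₂ : Matrix (Fin d₁) (Fin d₂) ℝ} (hX₁ : ∀ i j, X₁ i j = γ ∨ X₁ i j = -γ)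
    (hX₂ : ∀ i j, X₂ i j = γ ∨ X₂ i j = -γ) (t : Triple d₁ d₂) :
    ∫ y, outcomeLogRatio (scoreDiff X₁ t) (scoreDiff X₂ t) y ∂outcomeLaw X₁ t ≤ 8 * γ ^ 2 := by
  refine (integral_outcomeLogRatio_le X₁ X₂ t).trans ?_
  have h₁ := scoreDiff_eq_of_sign hX₁ t
  have h₂ := scoreDiff_eq_of_sign hX₂ t
  have e₁ := two_mul_sigmoid_sub_one hγ.ne' h₁
  have e₂ := two_mul_sigmoid_sub_one hγ.ne' h₂
  obtain ⟨hκ0, hκ⟩ := sigmoidSlope_bounds hγ hγ1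
  -- Each score difference is at most `2γ` in absolute value.
  have hsq : (scoreDiff X₁ t - scoreDiff X₂ t) ^ 2 ≤ 16 * γ ^ 2 := by
    rcases h₁ with h₁ | h₁ | h₁ <;> rcases h₂ with h₂ | h₂ | h₂ <;> rw [h₁, h₂] <;>
      nlinarith [sq_nonneg γ]
  calc _ = sigmoidSlope γ / 2 * (scoreDiff X₁ t - scoreDiff X₂ t) ^ 2 := by
        rw [show Real.sigmoid (scoreDiff X₁ t) = (1 + sigmoidSlope γ * scoreDiff X₁ t) / 2 by
          linarith, show Real.sigmoid (scoreDiff X₂ t) = (1 + sigmoidSlope γ * scoreDiff X₂ t) / 2 by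
          linarith]
        ring
    _ ≤ 1 / 2 * (16 * γ ^ 2) := by gcongr
    _ = _ := by ring

lemma klDiv_setSampleLaw_le {γ : ℝ} (hγ : 0 < γ) (hγ1 : γ ≤ 1) (hd₁ : 0 < d₁) (hd₂ : 0 < d₂)
    {X₁ X₂ : Matrix (Fin d₁) (Fin d₂) ℝ} (hX₁ : ∀ i j, X₁ i j = γ ∨ X₁ i j = -γ)
    (hX₂ : ∀ i j, X₂ i j = γ ∨ X₂ i j = -γ) (m : ℝ) (ν : Measure (Set (Triple d₁ d₂)))
    (hν : IsUniformSetSampling ν m) :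
    klDiv (setSampleLaw ν X₁) (setSampleLaw ν X₂) ≤ ENNReal.ofReal (8 * m * γ ^ 2) := by
  have := hν.1
  rw [klDiv_setSampleLaw]
  refine ENNReal.ofReal_le_ofReal ?_
  calc _ ≤ ∑ t : Triple d₁ d₂, m / ((d₁ : ℝ) * (d₂ : ℝ) ^ 2) * (8 * γ ^ 2) := by
        refine Finset.sum_le_sum fun t _ => ?_
        rw [← hν.2 t]
        gcongr
        exact integral_outcomeLogRatio_le_of_sign hγ hγ1 hX₁ hX₂ t
    _ = _ := by
        have : (d₁ : ℝ) ≠ 0 := by positivity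
        have : (d₂ : ℝ) ≠ 0 := by positivity
        simp [Triple]
        field_simp

lemma klDiv_iidSampleLaw_le {γ : ℝ} (hγ : 0 < γ) (hγ1 : γ ≤ 1) (hd₁ : 0 < d₁) (hd₂ : 0 < d₂)
    {X₁ X₂ : Matrix (Fin d₁) (Fin d₂) ℝ} (hX₁ : ∀ i j, X₁ i j = γ ∨ X₁ i j = -γ)
    (hX₂ : ∀ i j, X₂ i j = γ ∨ X₂ i j = -γ) (m : ℕ) :
    klDiv (iidSampleLaw m X₁) (iidSampleLaw m X₂) ≤ ENNReal.ofReal (8 * m * γ ^ 2) := by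
  have : Nonempty (Triple d₁ d₂) := ⟨(⟨0, hd₁⟩, ⟨0, hd₂⟩, ⟨0, hd₂⟩)⟩
  rw [klDiv_iidSampleLaw]
  refine ENNReal.ofReal_le_ofReal ?_
  calc _ ≤ (m : ℝ) * ∑ t : Triple d₁ d₂, (Fintype.card (Triple d₁ d₂) : ℝ)⁻¹ * (8 * γ ^ 2) := by
        gcongr with t
        exact integral_outcomeLogRatio_le_of_sign hγ hγ1 hX₁ hX₂ t
    _ = _ := by
        have : (Fintype.card (Triple d₁ d₂) : ℝ) ≠ 0 := by simp; omega
        rw [Finset.sum_const, Finset.card_univ, nsmul_eq_mul, mul_inv_cancel_left₀ this]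
        ring

/-- For balanced sign matrices the excess loss is a multiple of the squared Frobenius distance. -/
lemma averageExcessLoss_eq {γ : ℝ} (hγ : 0 < γ) (L : ℝ → ℝ)
    {X₁ X₂ : Matrix (Fin d₁) (Fin d₂) ℝ} (hX₁ : ∀ i j, X₁ i j = γ ∨ X₁ i j = -γ)
    (hX₂ : ∀ i j, X₂ i j = γ ∨ X₂ i j = -γ) (hsum : ∀ i, ∑ j, X₁ i j = ∑ j, X₂ i j) :
    averageExcessLoss L X₁ X₂ = sigmoidSlope γ * (-((L (2 * γ) - L (-(2 * γ))) / (4 * γ))) /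
      (d₁ * d₂) * ∑ i, ∑ j, (X₁ i j - X₂ i j) ^ 2 := by
  set b := (L (2 * γ) - L (-(2 * γ))) / (4 * γ) with hb
  set e := ((L (2 * γ) + L (-(2 * γ))) / 2 - L 0) / (4 * γ ^ 2) with he
  -- Quadratic interpolation of `L` at `0` and `±2γ`: `b` is the symmetric slope, `e` the even
  -- coefficient.
  have hpos {x : ℝ} (hx : x = 0 ∨ x = 2 * γ ∨ x = -(2 * γ)) : L x = L 0 + b * x + e * x ^ 2 := by
    rcases hx with rfl | rfl | rfl <;> rw [hb, he] <;> field_simp <;> ring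
  have hneg {x : ℝ} (hx : x = 0 ∨ x = 2 * γ ∨ x = -(2 * γ)) :
      L (-x) = L 0 - b * x + e * x ^ 2 := by
    rw [hpos (x := -x) (by rcases hx with rfl | rfl | rfl <;> simp)]; ring
  have hterm (i : Fin d₁) (j k : Fin d₂) :
      ∫ y, (L ((y : ℝ) * (X₂ i j - X₂ i k)) - L ((y : ℝ) * (X₁ i j - X₁ i k)))
        ∂(outcomeLaw X₁ (i, j, k)) =
      sigmoidSlope γ * b * ((X₁ i j - X₁ i k) *
        ((X₂ i j - X₁ i j) - (X₂ i k - X₁ i k))) + e * ((X₂ i j - X₂ i k) * (X₂ i j - X₂ i k)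
          - (X₁ i j - X₁ i k) * (X₁ i j - X₁ i k)) := by
    have h₁ := scoreDiff_eq_of_sign hX₁ (i, j, k)
    have h₂ := scoreDiff_eq_of_sign hX₂ (i, j, k)
    have h := two_mul_sigmoid_sub_one hγ.ne' h₁
    rw [integral_outcomeLaw, Real.sigmoid_neg]
    simp only [scoreDiff] at h₁ h₂ h ⊢
    simp only [Int.cast_one, one_mul, Int.cast_neg, neg_one_mul]
    rw [hpos h₁, hpos h₂, hneg h₁, hneg h₂,
      show Real.sigmoid (X₁ i j - X₁ i k) = (1 + sigmoidSlope γ * (X₁ i j - X₁ i k)) / 2 by linarith]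
    ring
  have hsq {X : Matrix (Fin d₁) (Fin d₂) ℝ} (hX : ∀ i j, X i j = γ ∨ X i j = -γ) (i j) :
      X i j * X i j = γ ^ 2 := by
    rcases hX i j with h | h <;> rw [h] <;> ring
  have hrow (i : Fin d₁) : ∑ j, ∑ k,
      ∫ y, (L ((y : ℝ) * (X₂ i j - X₂ i k)) - L ((y : ℝ) * (X₁ i j - X₁ i k)))
        ∂(outcomeLaw X₁ (i, j, k)) = sigmoidSlope γ * -b * d₂ * ∑ j, (X₁ i j - X₂ i j) ^ 2 := by
    have hprod (j : Fin d₂) : X₁ i j * (X₂ i j - X₁ i j) = -(1 / 2) * (X₁ i j - X₂ i j) ^ 2 := by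
      linear_combination (1 / 2) * hsq hX₂ i j - (1 / 2) * hsq hX₁ i j
    -- The `e` terms cancel because entries have equal squares and rows have equal sums; in the `b`
    -- term, equal row sums remove the product of sums.
    simp_rw [hterm, Finset.sum_add_distrib, ← Finset.mul_sum, Finset.sum_sub_distrib]
    rw [sum_sub_mul_sub (X₁ i) (fun j => X₂ i j - X₁ i j), sum_sub_mul_sub, sum_sub_mul_sub]
    simp_rw [hprod, hsq hX₁, hsq hX₂, Finset.sum_sub_distrib, hsum, ← Finset.mul_sum]
    ring
  rw [averageExcessLoss]
  simp_rw [hrow, ← Finset.mul_sum]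
  rcases Nat.eq_zero_or_pos d₂ with rfl | hd
  · simp
  · field_simp

end

/-! ### The slope of the loss at `0`. -/

/-- Near `0` the symmetric difference quotient is at most half of a negative derivative. -/
lemma exists_symmetric_slope_le {L : ℝ → ℝ} (hL : deriv L 0 < 0) :
    ∃ δ : ℝ, 0 < δ ∧ ∀ x, 0 < x → x < δ → |deriv L 0| / 2 ≤ -((L x - L (-x)) / (2 * x)) := by
  have hd : HasDerivAt L (deriv L 0) 0 :=
    -- `deriv` is `0` where `L` is not differentiable, so a negative value implies
    -- differentiability.
    (differentiableAt_of_deriv_ne_zero hL.ne).hasDerivAt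
  have ho := hd.isLittleO
  have := ho.def (c := |deriv L 0| / 2) (by have := abs_pos.2 hL.ne; positivity)
  obtain ⟨δ, hδ, h⟩ := Metric.eventually_nhds_iff.1 this
  refine ⟨δ, hδ, fun x hx hxδ => ?_⟩
  have h₁ := h (y := x) (by simpa [abs_of_pos hx] using hxδ)
  have h₂ := h (y := -x) (by simpa [abs_of_pos hx] using hxδ)
  simp only [sub_zero, smul_eq_mul, Real.norm_eq_abs, abs_neg, abs_of_pos hx] at h₁ h₂
  rw [abs_of_neg hL, abs_le] at *
  -- The errors at `x` and `-x` are each at most `|deriv L 0| / 2 * x`, against a main term `2 *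
  -- |deriv L 0| * x`.
  rw [← neg_div, le_div_iff₀ (by positivity)]
  nlinarith

/-! ### Balanced sign matrices with periodic rows. -/

/-- The sign of a bit. -/
def bitSign (s : Bool) : ℝ := if s then 1 else -1

/-- A sign vector with entries `s`, `-s` and `r` ones. Its sum does not depend on `s`. -/
def balancedSign {h r : ℕ} (s : Fin h → Bool) : (Fin h ⊕ Fin h) ⊕ Fin r → ℝ :=
  Sum.elim (Sum.elim (fun j => bitSign (s j)) fun j => -bitSign (s j)) 1

lemma bitSign_eq (s : Bool) : bitSign s = 1 ∨ bitSign s = -1 := by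
  cases s <;> simp [bitSign]

lemma balancedSign_eq {h r : ℕ} (s : Fin h → Bool) (a : (Fin h ⊕ Fin h) ⊕ Fin r) :
    balancedSign s a = 1 ∨ balancedSign s a = -1 := by
  rcases a with (j | j) | j
  · exact bitSign_eq (s j)
  · rcases bitSign_eq (s j) with h | h <;> simp [balancedSign, h]
  · exact Or.inl rfl

lemma sum_balancedSign {h r : ℕ} (s : Fin h → Bool) :
    ∑ a, balancedSign (r := r) s a = r := by
  simp [balancedSign]

/-- Each differing bit changes two coordinates, each by `2`, hence the factor `8`. -/
lemma sum_balancedSign_sub_sq {h r : ℕ} (s s' : Fin h → Bool) :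
    ∑ a, (balancedSign (r := r) s a - balancedSign s' a) ^ 2 = 8 * hammingDist s s' := by
  have h1 (j : Fin h) : (bitSign (s j) - bitSign (s' j)) ^ 2 = if s j ≠ s' j then 4 else 0 := by
    cases s j <;> cases s' j <;> norm_num [bitSign]
  have h2 (j : Fin h) : (-bitSign (s j) - -bitSign (s' j)) ^ 2 = if s j ≠ s' j then 4 else 0 := by
    rw [← h1]; ring
  simp only [balancedSign, Fintype.sum_sum_type, Sum.elim_inl, Sum.elim_inr, Pi.one_apply, sub_self,
    h1, h2]
  rw [← Finset.sum_filter, Finset.sum_const, hammingDist]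
  simp
  ring

lemma sum_hammingDist_slices {ι κ : Type*} [Fintype ι] [Fintype κ] (x y : ι × κ → Bool) :
    ∑ i, hammingDist (fun j => x (i, j)) (fun j => y (i, j)) = hammingDist x y := by
  simp only [hammingDist, Finset.card_filter]
  rw [Fintype.sum_prod_type]

/-- Every residue class modulo `B` meets an initial segment of length `d ≥ B` in at least
`d / (2 * B)` points. -/
lemma le_two_mul_sum_mod {d B : ℕ} (hB : 0 < B) (hBd : B ≤ d) (f : Fin B → ℝ) (hf : ∀ b, 0 ≤ f b) :
    (d : ℝ) * ∑ b, f b ≤ 2 * B * ∑ i : Fin d, f ⟨i % B, Nat.mod_lt _ hB⟩ := by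
  have hq : d / B * B ≤ d := Nat.div_mul_le_self d B
  have hsum : (d / B : ℕ) * ∑ b, f b ≤ ∑ i : Fin d, f ⟨i % B, Nat.mod_lt _ hB⟩ := by
    let φ : Fin (d / B) × Fin B → Fin d := fun p => Fin.castLE hq (finProdFinEquiv p)
    have hφ : Function.Injective φ :=
      (Fin.castLE_injective hq).comp finProdFinEquiv.injective
    calc _ = ∑ p : Fin (d / B) × Fin B, f ⟨φ p % B, Nat.mod_lt _ hB⟩ := by
          have h (p : Fin (d / B) × Fin B) : (⟨φ p % B, Nat.mod_lt _ hB⟩ : Fin B) = p.2 := by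
            ext
            simp [φ, finProdFinEquiv, Nat.mod_eq_of_lt p.2.2]
          simp_rw [h, Fintype.sum_prod_type]
          simp
      _ = ∑ i ∈ Finset.univ.map ⟨φ, hφ⟩, f ⟨i % B, Nat.mod_lt _ hB⟩ := by simp
      _ ≤ _ := Finset.sum_le_sum_of_subset_of_nonneg (Finset.subset_univ _) fun _ _ _ => hf _
  -- With `q = d / B ≥ 1`, `d < q B + B ≤ 2 q B`.
  have hd : (d : ℝ) ≤ 2 * B * (d / B : ℕ) := by
    have h1 := Nat.lt_div_mul_add (a := d) hB
    have h2 : 1 ≤ d / B := (Nat.one_le_div_iff hB).2 hBd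
    have : d ≤ 2 * B * (d / B) := by nlinarith
    exact_mod_cast this
  calc (d : ℝ) * ∑ b, f b ≤ 2 * B * (d / B : ℕ) * ∑ b, f b := by
        gcongr; exact Finset.sum_nonneg fun b _ => hf b
    _ = 2 * B * ((d / B : ℕ) * ∑ b, f b) := by ring
    _ ≤ _ := by gcongr

/-- A matrix of rank at most `B` with entries `±γ` lies in the nuclear norm ball. -/
lemma mem_smul_nuclearBall {d₁ d₂ B : ℕ} {γ lam : ℝ} (hγ : 0 < γ) (hlam : 0 < lam)
    (hB : (B : ℝ) = lam * (γ ^ 2)⁻¹) (hd₁ : 0 < d₁) (hd₂ : 0 < d₂)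
    {X : Matrix (Fin d₁) (Fin d₂) ℝ} (hX : ∀ i j, X i j = γ ∨ X i j = -γ) (hr : X.rank ≤ B) :
    X ∈ Real.sqrt (lam * d₁ * d₂) • nuclearBall d₁ d₂ := by
  set a := Real.sqrt (lam * d₁ * d₂)
  have ha : 0 < a := by positivity
  have ha2 : a ^ 2 = lam * d₁ * d₂ := Real.sq_sqrt (by positivity)
  refine (Set.mem_smul_set_iff_inv_smul_mem₀ ha.ne' _ _).2 ?_
  have hsq (i j) : (a⁻¹ • X) i j ^ 2 = γ ^ 2 / a ^ 2 := by
    rw [Matrix.smul_apply, smul_eq_mul]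
    rcases hX i j with h | h <;> rw [h] <;> field_simp
  have hrank : (a⁻¹ • X).rank ≤ B := by
    rw [← Matrix.one_mul X, ← Matrix.smul_mul]
    exact (Matrix.rank_mul_le_right _ _).trans hr
  have h := nuclearNorm_sq_le (a⁻¹ • X)
  simp_rw [hsq] at h
  have h1 : nuclearNorm (a⁻¹ • X) ^ 2 ≤ 1 := by
    refine h.trans ?_
    -- The hypothesis on `B` makes `B d₁ d₂ γ² / a² = B γ² / lam` equal to `1`.
    calc _ ≤ (B : ℝ) * ∑ _i : Fin d₁, ∑ _j : Fin d₂, γ ^ 2 / a ^ 2 := by gcongr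
      _ = 1 := by
        rw [hB, ha2]
        simp
        field_simp
  exact (abs_le.1 ((sq_le_one_iff_abs_le_one _).1 h1)).2

/-- The sign matrix with periodically repeated rows coded by `x`. -/
def signMatrix {d₁ d₂ B h r : ℕ} (hB : 0 < B) (e : Fin d₂ ≃ (Fin h ⊕ Fin h) ⊕ Fin r) (γ : ℝ)
    (x : Fin B × Fin h → Bool) : Matrix (Fin d₁) (Fin d₂) ℝ :=
  Matrix.of fun i j => γ * balancedSign (fun q => x (⟨i % B, Nat.mod_lt _ hB⟩, q)) (e j)

section

variable {d₁ d₂ B h r : ℕ} (hB : 0 < B) (e : Fin d₂ ≃ (Fin h ⊕ Fin h) ⊕ Fin r) (γ : ℝ)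

lemma signMatrix_eq (x : Fin B × Fin h → Bool) (i : Fin d₁) (j : Fin d₂) :
    signMatrix hB e γ x i j = γ ∨ signMatrix hB e γ x i j = -γ := by
  rcases balancedSign_eq (fun q => x (⟨i % B, Nat.mod_lt _ hB⟩, q)) (e j) with h | h <;>
    simp [signMatrix, h]

/-- There are at most `B` different rows. -/
lemma rank_signMatrix_le (x : Fin B × Fin h → Bool) :
    (signMatrix hB e γ x : Matrix (Fin d₁) (Fin d₂) ℝ).rank ≤ B := by
  have hX : (signMatrix hB e γ x : Matrix (Fin d₁) (Fin d₂) ℝ) =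
      (Matrix.of fun b j => γ * balancedSign (fun q => x (b, q)) (e j)).submatrix
        (fun i : Fin d₁ => (⟨i % B, Nat.mod_lt _ hB⟩ : Fin B)) (Equiv.refl (Fin d₂)) := rfl
  rw [hX]
  exact (Matrix.rank_submatrix_le _ _ _).trans (Matrix.rank_le_height _)

lemma sum_signMatrix (x : Fin B × Fin h → Bool) (i : Fin d₁) :
    ∑ j, signMatrix hB e γ x i j = γ * r := by
  simp only [signMatrix, Matrix.of_apply, ← Finset.mul_sum]
  rw [e.sum_comp, sum_balancedSign]

/-- A row contributes `8γ²` per differing bit, and periodic repetition loses at most a factor `2`,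
leaving `4γ²`. -/
lemma le_sum_signMatrix_sub_sq (hBd : B ≤ d₁) (x y : Fin B × Fin h → Bool) :
    4 * γ ^ 2 * d₁ * hammingDist x y ≤ B * ∑ i : Fin d₁, ∑ j,
      (signMatrix hB e γ x i j - signMatrix hB e γ y i j) ^ 2 := by
  have hrow (i : Fin d₁) : ∑ j, (signMatrix hB e γ x i j - signMatrix hB e γ y i j) ^ 2 =
      γ ^ 2 * 8 * (hammingDist (fun q => x (⟨i % B, Nat.mod_lt _ hB⟩, q))
        (fun q => y (⟨i % B, Nat.mod_lt _ hB⟩, q)) : ℝ) := by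
    simp only [signMatrix, Matrix.of_apply, ← mul_sub, mul_pow, ← Finset.mul_sum]
    rw [e.sum_comp (fun a => (balancedSign (fun q => x (⟨i % B, Nat.mod_lt _ hB⟩, q)) a -
      balancedSign (fun q => y (⟨i % B, Nat.mod_lt _ hB⟩, q)) a) ^ 2), sum_balancedSign_sub_sq]
    ring
  have h := le_two_mul_sum_mod hB hBd
    (fun b => (hammingDist (fun q => x (b, q)) (fun q => y (b, q)) : ℝ)) fun b => by positivity
  rw [← Nat.cast_sum, sum_hammingDist_slices] at h
  simp_rw [hrow, ← Finset.mul_sum]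
  nlinarith [mul_le_mul_of_nonneg_left h (by positivity : 0 ≤ 4 * γ ^ 2)]

lemma signMatrix_injective (hγ : γ ≠ 0) (hBd : B ≤ d₁) : Function.Injective
    (signMatrix hB e γ : _ → Matrix (Fin d₁) (Fin d₂) ℝ) := by
  intro x y hxy
  have h := le_sum_signMatrix_sub_sq hB e γ hBd x y
  rw [hxy] at h
  have hd : (0 : ℝ) < d₁ := by exact_mod_cast hB.trans_le hBd
  have hc : 0 < 4 * γ ^ 2 * d₁ := by positivity
  simp only [sub_self, ne_eq, OfNat.ofNat_ne_zero, not_false_eq_true, zero_pow,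
    Finset.sum_const_zero, mul_zero] at h
  have : (hammingDist x y : ℝ) ≤ 0 := by
    by_contra! hlt
    exact absurd h (not_le.2 (mul_pos hc hlt))
  exact hammingDist_eq_zero.1 (by exact_mod_cast le_antisymm this (by positivity))

end

/-! ### Assembly and constants. -/

theorem mainTheorem2 :
    ∃ c C : ℝ, 0 < c ∧ c < C ∧
      ∀ L : ℝ → ℝ, deriv L 0 < 0 →
        ∃ γ₀ : ℝ, 0 < γ₀ ∧
          ∀ γ : ℝ, 0 < γ → γ < γ₀ →
          ∀ (lam : ℝ) (d₁ d₂ B : ℕ), 0 < lam → (B : ℝ) = lam * (γ ^ 2)⁻¹ → B ≤ d₁ → 2 ≤ d₂ →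
            ∃ S : Finset (Matrix (Fin d₁) (Fin d₂) ℝ),
              (∀ X ∈ S, X ∈ Real.sqrt (lam * d₁ * d₂) • nuclearBall d₁ d₂) ∧
              Real.exp (c * B * d₂) ≤ (S.card : ℝ) ∧
              (∀ X₁ ∈ S, ∀ X₂ ∈ S, X₁ ≠ X₂ →
                c * |deriv L 0| * γ ^ 2 ≤ averageExcessLoss L X₁ X₂) ∧
              (∀ X₁ ∈ S, ∀ X₂ ∈ S,
                (∀ (m : ℝ) (ν : Measure (Set (Triple d₁ d₂))), IsUniformSetSampling ν m →
                  klDiv (setSampleLaw ν X₁) (setSampleLaw ν X₂)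
                    ≤ ENNReal.ofReal (C * m * γ ^ 2)) ∧
                (∀ m : ℕ,
                  klDiv (iidSampleLaw m X₁) (iidSampleLaw m X₂)
                    ≤ ENNReal.ofReal (C * m * γ ^ 2))) := by
  -- `1 / 48 = 1 / 4 * 1 / 2 * 1 / 6`: the lower bounds for the logistic slope, the loss slope and
  -- the normalized squared distance. The packing alone would allow `1 / 24`.
  refine ⟨1 / 48, 8, by norm_num, by norm_num, fun L hL => ?_⟩
  obtain ⟨δ, hδ, hslope⟩ := exists_symmetric_slope_le hL
  -- The bound `1` serves `sigmoidSlope_bounds`; `δ / 2` puts the score difference `2γ` in the range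
  -- of `hslope`.
  refine ⟨min 1 (δ / 2), by positivity, fun γ hγ hγ₀ lam d₁ d₂ B hlam hBeq hBd hd₂ => ?_⟩
  have hγ1 : γ ≤ 1 := (hγ₀.trans_le (min_le_left _ _)).le
  have hγδ : 2 * γ < δ := by linarith [hγ₀.trans_le (min_le_right 1 (δ / 2))]
  have hB : 0 < B := by
    have : (0 : ℝ) < B := by rw [hBeq]; positivity
    exact_mod_cast this
  have hd₁ : 0 < d₁ := hB.trans_le hBd
  have hd₂' : 0 < d₂ := by omega
  -- The bound `d₂ ≤ 3 * h` needs `2 ≤ d₂` and is sharp at `d₂ = 3`.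
  obtain ⟨h, r, hhr, hh⟩ : ∃ h r : ℕ, h + h + r = d₂ ∧ d₂ ≤ 3 * h :=
    ⟨d₂ / 2, d₂ % 2, by omega, by omega⟩
  let e : Fin d₂ ≃ (Fin h ⊕ Fin h) ⊕ Fin r := Fintype.equivOfCardEq (by simp [hhr])
  obtain ⟨F, hFcard, hFdist⟩ := exists_hammingDist_packing (Fin B × Fin h)
  let X : (Fin B × Fin h → Bool) → Matrix (Fin d₁) (Fin d₂) ℝ := signMatrix hB e γ
  have hX (x) : ∀ i j, X x i j = γ ∨ X x i j = -γ := signMatrix_eq hB e γ x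
  have hN : (Fintype.card (Fin B × Fin h) : ℝ) = B * h := by simp
  have hhR : (d₂ : ℝ) ≤ 3 * h := by exact_mod_cast hh
  have hBR : (0 : ℝ) < B := by exact_mod_cast hB
  refine ⟨F.map ⟨X, signMatrix_injective hB e γ hγ.ne' hBd⟩, ?_, ?_, ?_, ?_⟩
  · simp only [Finset.mem_map, Function.Embedding.coeFn_mk]
    rintro _ ⟨x, -, rfl⟩
    exact mem_smul_nuclearBall hγ hlam hBeq hd₁ hd₂' (hX x) (rank_signMatrix_le hB e γ x)
  · rw [Finset.card_map]
    refine le_trans (Real.exp_le_exp.2 ?_) hFcard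
    rw [hN]
    nlinarith
  · simp only [Finset.mem_map, Function.Embedding.coeFn_mk]
    rintro _ ⟨x, hx, rfl⟩ _ ⟨y, hy, rfl⟩ hxy
    have hdist := hFdist x hx y hy fun h => hxy (congrArg X h)
    have hdistR : (B : ℝ) * h ≤ 8 * hammingDist x y := by
      rw [← hN]; exact_mod_cast hdist
    rw [averageExcessLoss_eq hγ L (hX x) (hX y) fun i => by
      rw [sum_signMatrix, sum_signMatrix]]
    have hs := hslope (2 * γ) (by positivity) hγδ
    rw [show 2 * (2 * γ) = 4 * γ by ring] at hs
    have hκ := (sigmoidSlope_bounds hγ hγ1).1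
    -- The Hamming distance is at least `B h / 8 ≥ B d₂ / 24`, and `4 / 24 = 1 / 6`.
    have hsq : γ ^ 2 * d₁ * d₂ / 6 ≤ ∑ i, ∑ j, (X x i j - X y i j) ^ 2 := by
      refine le_of_mul_le_mul_left (le_trans ?_ (le_sum_signMatrix_sub_sq hB e γ hBd x y)) hBR
      have h1 : (B : ℝ) * d₂ ≤ 24 * hammingDist x y := by nlinarith
      calc (B : ℝ) * (γ ^ 2 * d₁ * d₂ / 6) = γ ^ 2 * d₁ / 6 * (B * d₂) := by ring
        _ ≤ γ ^ 2 * d₁ / 6 * (24 * hammingDist x y) := by gcongr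
        _ = _ := by ring
    calc 1 / 48 * |deriv L 0| * γ ^ 2
        = 1 / 4 * (|deriv L 0| / 2) / (d₁ * d₂) * (γ ^ 2 * d₁ * d₂ / 6) := by
          field_simp
          ring
      _ ≤ _ := by
        have hslope_nonneg := (by positivity : 0 ≤ |deriv L 0| / 2).trans hs
        have hκ_nonneg : 0 ≤ sigmoidSlope γ := by linarith
        gcongr
  · simp only [Finset.mem_map, Function.Embedding.coeFn_mk]
    rintro _ ⟨x, -, rfl⟩ _ ⟨y, -, rfl⟩
    exact ⟨fun m ν hν => klDiv_setSampleLaw_le hγ hγ1 hd₁ hd₂' (hX x) (hX y) m ν hν,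
      fun m => klDiv_iidSampleLaw_le hγ hγ1 hd₁ hd₂' (hX x) (hX y) m⟩
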